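/- Let $\mathcal H_n=(\mathbb C^2)^{\otimes n}$ and, for $0\le i\le n$, let $\mathcal E_i$ be the set of operators $E=\tau_1\otimes\cdots\otimes\tau_n$ in which every $\tau_j$ is the identity or one of the three Pauli matrices, exactly $i$ of them being nonidentical. For a $K$-dimensional subspace $Q\subseteq\mathcal H_n$, $K\ge1$, with orthogonal projection $P$ let $$B_i=\frac1{K^2}\sum_{E\in\mathcal E_i}|\mathrm{Tr}(EP)|^2,\qquad B_i^\bot=\frac1K\sum_{E\in\mathcal E_i}\mathrm{Tr}(EPE^*P),$$ and let $$P_{ue}(Q,p)=\sum_{i=1}^n(B_i^\bot-B_i)\Big(\frac p3\Big)^i(1-p)^{n-i}$$ be the probability of undetected error of the quantum code $Q$. Let $P_{ue}(n,K,p)=\min_{\dim Q=K}P_{ue}(Q,p)$ and $$E(n,R_Q,p)=-\frac1n\log_4P_{ue}(n,\lceil2^{R_Qn}\rceil,p)\in[-\infty,\infty],\qquad \underline E(R_Q,p)=\liminf_{n\to\infty}E(n,R_Q,p)$$ (with $-\log_40=\infty$). Put $$T_4(x,y)=x\log_43-x\log_4y-(1-x)\log_4(1-y),\qquad H_4(x)=T_4(x,x)$$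 (with $0\log_4 0=0$), and let $H_4^{-1}:[0,1]\to[0,\tfrac34]$ be the inverse of the restriction of $H_4$ to $[0,\tfrac34]$. Then for all $0<p\le1$ and $0\le R_Q\le1$ $$\underline E(R_Q,p)\ge\begin{cases}T_4\big(H_4^{-1}\big(\tfrac12(1-R_Q)\big),p\big)&\text{if } R_Q\le2(1-H_4(p))-1,\\[1mm]\tfrac12(1-R_Q)&\text{if } R_Q\ge2(1-H_4(p))-1.\end{cases}$$ In particular the same lower bound holds for the limit $E(R_Q,p)=\lim_{n\to\infty}E(n,R_Q,p)$ whenever it exists. -/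

import Mathlib

noncomputable section

namespace QuantumErrorDetection

/-- `T_q(x,y) = x log_q (q-1) - x log_q y - (1-x) log_q (1-y)`. -/
def T (q x y : ℝ) : ℝ :=
  x * Real.logb q (q - 1) - x * Real.logb q y - (1 - x) * Real.logb q (1 - y)

/-- The `q`-ary entropy function `H_q(x) = T_q(x,x)`. -/
def H (q x : ℝ) : ℝ := T q x x

/-- The inverse of `H_q`, taken on the interval `[0, 1 - 1/q]`, on which `H_q` increases
from `0` to `1`. -/
def Hinv (q : ℝ) : ℝ → ℝ := Function.invFunOn (H q) (Set.Icc 0 (1 - 1 / q))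

/-- The state space `(ℂ²)^{⊗ n}` of `n` qubits, in coordinates with respect to the
computational basis, which is indexed by the words of length `n` over `{0, 1}`. -/
abbrev Qubits (n : ℕ) : Type := EuclideanSpace ℂ (Fin n → Fin 2)

/-- The identity and the three Pauli matrices. -/
def pauli : Fin 4 → Matrix (Fin 2) (Fin 2) ℂ :=
  ![1, !![0, 1; 1, 0], !![0, -Complex.I; Complex.I, 0], !![1, 0; 0, -1]]

/-- The error operator `τ₁ ⊗ ⋯ ⊗ τₙ`, where `τⱼ = pauli (s j)`. -/
def errorOp {n : ℕ} (s : Fin n → Fin 4) : Matrix (Fin n → Fin 2) (Fin n → Fin 2) ℂ :=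
  Matrix.of fun x y => ∏ j, pauli (s j) (x j) (y j)

/-- The number of nonidentity tensor factors of `errorOp s`. -/
def weight {n : ℕ} (s : Fin n → Fin 4) : ℕ := (Finset.univ.filter fun j => s j ≠ 0).card

/-- The matrix of the orthogonal projection onto the quantum code `Q`. -/
def proj {n : ℕ} (Q : Submodule ℂ (Qubits n)) : Matrix (Fin n → Fin 2) (Fin n → Fin 2) ℂ :=
  (Matrix.toEuclideanCLM (n := Fin n → Fin 2) (𝕜 := ℂ)).symm Q.starProjection

/-- The Shor-Laflamme weight distribution
`B_i = K⁻² ∑_{wt E = i} |Tr (E P)|²`, where `K = dim Q`. -/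
def B {n : ℕ} (Q : Submodule ℂ (Qubits n)) (i : ℕ) : ℝ :=
  (1 / (Module.finrank ℂ Q : ℝ) ^ 2) *
    ∑ s : Fin n → Fin 4 with weight s = i, ‖(errorOp s * proj Q).trace‖ ^ 2

/-- The dual Shor-Laflamme weight distribution
`B_i^⊥ = K⁻¹ ∑_{wt E = i} Tr (E P E* P)`, where `K = dim Q`. (Every trace in this sum is
real, being the squared Hilbert-Schmidt norm of `P E P`.) -/
def Bperp {n : ℕ} (Q : Submodule ℂ (Qubits n)) (i : ℕ) : ℝ :=
  (1 / (Module.finrank ℂ Q : ℝ)) *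
    ∑ s : Fin n → Fin 4 with weight s = i,
      (errorOp s * proj Q * (errorOp s).conjTranspose * proj Q).trace.re

/-- The probability of undetected error of the code `Q`. -/
def Pue {n : ℕ} (Q : Submodule ℂ (Qubits n)) (p : ℝ) : ℝ :=
  ∑ i ∈ Finset.Icc 1 n, (Bperp Q i - B Q i) * (p / 3) ^ i * (1 - p) ^ (n - i)

/-- The smallest probability of undetected error of an `((n, K))` quantum code. (The numbers
`Pue Q p` are nonnegative for `0 ≤ p ≤ 1`, because `B_i ≤ B_i^⊥` by Cauchy-Schwarz.) -/
def minPue (n K : ℕ) (p : ℝ) : ENNReal :=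
  ⨅ (Q : Submodule ℂ (Qubits n)) (_ : Module.finrank ℂ Q = K), ENNReal.ofReal (Pue Q p)

/-- The exponent of undetected error `-(1/n) log₄ P_ue(n, ⌈2^{Rn}⌉, p)`, an extended real
number: it is `⊤` if the probability is zero, since `ENNReal.log 0 = ⊥`. -/
def exponent (n : ℕ) (R p : ℝ) : EReal :=
  -(ENNReal.log (minPue n ⌈(2 : ℝ) ^ (R * n)⌉₊ p) / ((n * Real.log 4 : ℝ) : EReal))

/-- The asymptotic exponent `liminf_{n → ∞} E(n, R, p)`. -/
def lowerExponent (R p : ℝ) : EReal :=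
  Filter.liminf (fun n : ℕ => exponent n R p) Filter.atTop

end QuantumErrorDetection

end

/-! ### Projections and traces of compressed operators -/

noncomputable section

namespace QuantumErrorDetection

open Matrix

/-! The proof is a random coding argument over subspaces spanned by graph states. A symmetric matrix
`M` over 𝔽₂ gives an orthonormal basis of graph states indexed by words, on which a Pauli operator
with bit-flip part `a` and phase-flip part `b` acts, up to phases, as translation by `b + Ma`
(`exists_graph_code`). If the index set lies in the kernel of an `m × n` matrix `A`, only errors
with `A(b + Ma) = 0` contribute to `Bperp`, so `Bperp Q i` is at most the number of such errors of
weight `i`.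

For uniform `M` and `A` a fixed nonidentity error passes with probability at most `2 / 2^m`.
Markov's inequality and a union bound over weights give one code that is good for all weights at
once, at the cost of a factor `n`. Since the counts are integers, `Bperp` is nonpositive at every
weight where the bound is below 1 (`exists_code_forall_Bperp_le`).

Dropping `B ≥ 0` and summing all weights gives the exponent `(1 - R) / 2`, with no condition on `R`
versus `p`. For small `R` the expurgation of low weights helps: surviving weights are at least `δn -
O(log n)` with `H 4 δ = (1 - R) / 2`, and since `p ≤ δ` every surviving term is at most `4^(-n T 4 δ
p)` up to a polynomial factor (`log_tail_bound`). -/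

open scoped ComplexOrder in
theorem exists_proj_eq_mul_conjTranspose {n : ℕ} {ι : Type*} [Fintype ι] [DecidableEq ι]
    (V : Matrix (Fin n → Fin 2) ι ℂ) (hV : Vᴴ * V = 1) :
    ∃ Q : Submodule ℂ (Qubits n), Module.finrank ℂ Q = Fintype.card ι ∧ proj Q = V * Vᴴ := by
  have hP : IsStarProjection (V * Vᴴ) := by
    refine ⟨?_, ?_⟩
    · change V * Vᴴ * (V * Vᴴ) = V * Vᴴ
      rw [Matrix.mul_assoc, ← Matrix.mul_assoc Vᴴ, hV, Matrix.one_mul]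
    · change (V * Vᴴ)ᴴ = V * Vᴴ
      simp
  have hP' := hP.map (toEuclideanCLM (n := Fin n → Fin 2) (𝕜 := ℂ))
  obtain ⟨h, hQ⟩ := isStarProjection_iff_eq_starProjection_range.mp hP'
  refine ⟨(toEuclideanCLM (n := Fin n → Fin 2) (𝕜 := ℂ) (V * Vᴴ)).range, ?_, ?_⟩
  · have h1 : (V * Vᴴ).rank = Fintype.card ι := by
      rw [rank_self_mul_conjTranspose, ← rank_conjTranspose_mul_self, hV, rank_one]
    rw [← h1, Matrix.rank_eq_finrank_range_toLin (V * Vᴴ)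
      (PiLp.basisFun 2 ℂ (Fin n → Fin 2)) (PiLp.basisFun 2 ℂ (Fin n → Fin 2))]
    rfl
  · rw [proj, StarAlgEquiv.symm_apply_eq]
    exact hQ.symm

theorem re_trace_mul_conjTranspose {ι κ : Type*} [Fintype ι] [Fintype κ]
    (A : Matrix ι κ ℂ) : (A * Aᴴ).trace.re = ∑ i, ∑ j, ‖A i j‖ ^ 2 := by
  simp only [trace, diag_apply, mul_apply, conjTranspose_apply, Complex.re_sum]
  refine Finset.sum_congr rfl fun i _ => Finset.sum_congr rfl fun j _ => ?_
  rw [← Complex.normSq_eq_norm_sq, Complex.star_def, Complex.mul_conj, Complex.ofReal_re]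

theorem re_trace_compression {m ι : Type*} [Fintype m] [Fintype ι]
    (V : Matrix m ι ℂ) (E : Matrix m m ℂ) :
    (E * (V * Vᴴ) * Eᴴ * (V * Vᴴ)).trace.re = ∑ c, ∑ d, ‖(Vᴴ * E * V) c d‖ ^ 2 := by
  rw [← re_trace_mul_conjTranspose]
  congr 1
  have : E * (V * Vᴴ) * Eᴴ * (V * Vᴴ) = (E * V * Vᴴ * Eᴴ * V) * Vᴴ := by
    simp only [Matrix.mul_assoc]
  rw [this, trace_mul_comm]
  simp only [conjTranspose_mul, conjTranspose_conjTranspose, Matrix.mul_assoc]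

/-! ### Characters and quadratic phases on 𝔽₂ⁿ -/

open scoped Fin.CommRing

/-- The sign `(-1)^{ab}` of two bits. -/
def bitSign (a b : Fin 2) : ℂ := if a = 1 ∧ b = 1 then -1 else 1

theorem bitSign_comm (a b : Fin 2) : bitSign a b = bitSign b a := by
  simp only [bitSign, and_comm]

theorem bitSign_add_left (a b x : Fin 2) : bitSign (a + b) x = bitSign a x * bitSign b x := by
  fin_cases a <;> fin_cases b <;> fin_cases x <;> simp [bitSign]

theorem bitSign_zero_left (x : Fin 2) : bitSign 0 x = 1 := by
  simp [bitSign]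

theorem bitSign_sum_left {ι : Type*} (s : Finset ι) (f : ι → Fin 2) (x : Fin 2) :
    bitSign (∑ i ∈ s, f i) x = ∏ i ∈ s, bitSign (f i) x := by
  classical
  induction s using Finset.induction_on with
  | empty => simp [bitSign_zero_left]
  | insert a s ha ih => rw [Finset.sum_insert ha, Finset.prod_insert ha, bitSign_add_left, ih]

theorem bitSign_mul_eq_pow (a b x : Fin 2) :
    bitSign (a * b) x = (-1) ^ (x.val * (a.val * b.val)) := by
  fin_cases a <;> fin_cases b <;> fin_cases x <;> simp [bitSign]

theorem norm_bitSign (a b : Fin 2) : ‖bitSign a b‖ = 1 := by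
  unfold bitSign; split_ifs <;> simp

theorem star_bitSign (a b : Fin 2) : star (bitSign a b) = bitSign a b := by
  unfold bitSign; split_ifs <;> simp

theorem sum_bitSign (c : Fin 2) : ∑ t, bitSign c t = if c = 0 then 2 else 0 := by
  fin_cases c <;> simp [bitSign]

variable {n : ℕ}

/-- The character `x ↦ (-1)^{c·x}` of `𝔽₂ⁿ`. -/
def wordSign (c x : Fin n → Fin 2) : ℂ := ∏ j, bitSign (c j) (x j)

theorem wordSign_comm (c x : Fin n → Fin 2) : wordSign c x = wordSign x c := by
  simp only [wordSign, bitSign_comm]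

theorem wordSign_add_left (c d x : Fin n → Fin 2) :
    wordSign (c + d) x = wordSign c x * wordSign d x := by
  simp only [wordSign, Pi.add_apply, bitSign_add_left, Finset.prod_mul_distrib]

theorem wordSign_add_right (c x y : Fin n → Fin 2) :
    wordSign c (x + y) = wordSign c x * wordSign c y := by
  simp only [wordSign_comm c, wordSign_add_left]

theorem norm_wordSign (c x : Fin n → Fin 2) : ‖wordSign c x‖ = 1 := by
  simp [wordSign, norm_prod, norm_bitSign]

theorem star_wordSign (c x : Fin n → Fin 2) : star (wordSign c x) = wordSign c x := by
  simp [wordSign, star_prod, star_bitSign]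

theorem sum_wordSign (c : Fin n → Fin 2) :
    ∑ x, wordSign c x = if c = 0 then (2 : ℂ) ^ n else 0 := by
  have h : ∑ x, wordSign c x = ∏ j, ∑ t, bitSign (c j) t := by
    rw [Finset.prod_univ_sum, Fintype.piFinset_univ]
    rfl
  rw [h]
  split_ifs with hc
  · subst hc
    simp only [Pi.zero_apply, sum_bitSign, if_true, Finset.prod_const, Finset.card_univ,
      Fintype.card_fin]
  · obtain ⟨j, hj⟩ := Function.ne_iff.mp hc
    exact Finset.prod_eq_zero (Finset.mem_univ j) ((sum_bitSign _).trans (if_neg hj))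

/-- The phase is `i^(xᵀMx)`, computed on integer lifts. The lift of `x + a` is the sum of the lifts
minus twice the carry word; by symmetry the carries change the exponent by a multiple of 4, and the
cross term `2 xᵀMa` becomes a sign. -/
theorem exists_quadratic_phase (M : Matrix (Fin n) (Fin n) (Fin 2)) (hM : M.IsSymm) :
    ∃ φ : (Fin n → Fin 2) → ℂ, (∀ x, ‖φ x‖ = 1) ∧
      ∀ x a, φ (x + a) = φ x * φ a * wordSign (M *ᵥ a) x := by
  let N : Matrix (Fin n) (Fin n) ℤ := M.map fun b => (b.val : ℤ)
  have hN : Nᵀ = N := by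
    change (M.map _)ᵀ = _
    rw [← Matrix.transpose_map, hM.eq]
  let l : (Fin n → Fin 2) → Fin n → ℤ := fun x j => (x j).val
  have hsign : ∀ x a, wordSign (M *ᵥ a) x = (-1 : ℂ) ^ (l x ⬝ᵥ N *ᵥ l a) := by
    intro x a
    have h1 : l x ⬝ᵥ N *ᵥ l a =
        ((∑ j, ∑ k, (x j).val * ((M j k).val * (a k).val) : ℕ) : ℤ) := by
      simp [dotProduct, mulVec, l, N, Finset.mul_sum]
    rw [h1, zpow_natCast, ← Finset.prod_pow_eq_pow_sum]
    refine Finset.prod_congr rfl fun j _ => ?_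
    rw [← Finset.prod_pow_eq_pow_sum, mulVec, dotProduct, bitSign_sum_left]
    exact Finset.prod_congr rfl fun k _ => bitSign_mul_eq_pow _ _ _
  have hsymm : ∀ u v : Fin n → ℤ, u ⬝ᵥ N *ᵥ v = v ⬝ᵥ N *ᵥ u := by
    intro u v
    rw [dotProduct_mulVec, ← mulVec_transpose, hN, dotProduct_comm]
  refine ⟨fun x => Complex.I ^ (l x ⬝ᵥ N *ᵥ l x), fun x => by simp, fun x a => ?_⟩
  let e : Fin n → ℤ := fun j => (x j).val * (a j).val
  have hl : l (x + a) = l x + l a + (-2 : ℤ) • e := by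
    funext j
    simp only [l, e, Pi.add_apply, Pi.smul_apply, smul_eq_mul]
    generalize x j = u
    generalize a j = v
    fin_cases u <;> fin_cases v <;> simp
  have hq : l (x + a) ⬝ᵥ N *ᵥ l (x + a) = l x ⬝ᵥ N *ᵥ l x + l a ⬝ᵥ N *ᵥ l a
      + 2 * (l x ⬝ᵥ N *ᵥ l a) + 4 * (e ⬝ᵥ N *ᵥ e - e ⬝ᵥ N *ᵥ l x - e ⬝ᵥ N *ᵥ l a) := by
    rw [hl]
    simp only [mulVec_add, add_dotProduct, dotProduct_add, mulVec_smul, smul_dotProduct,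
      dotProduct_smul, smul_eq_mul]
    rw [hsymm (l x) e, hsymm (l a) e, hsymm (l a) (l x)]
    ring
  have h4 : Complex.I ^ (4 : ℤ) = 1 := by
    rw [show (4 : ℤ) = ((4 : ℕ) : ℤ) from rfl, zpow_natCast, Complex.I_pow_four]
  have h2 : Complex.I ^ (2 : ℤ) = -1 := by
    rw [show (2 : ℤ) = ((2 : ℕ) : ℤ) from rfl, zpow_natCast, Complex.I_sq]
  rw [hsign]
  dsimp only
  rw [hq, zpow_add₀ Complex.I_ne_zero, zpow_add₀ Complex.I_ne_zero, zpow_add₀ Complex.I_ne_zero,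
    _root_.zpow_mul, _root_.zpow_mul, h4, h2, _root_.one_zpow, mul_one]

/-! ### Pauli operators as translations with characters -/

/-- The bit-flip part of a word of Pauli labels. -/
def flipPart (s : Fin n → Fin 4) : Fin n → Fin 2 := fun j => ![0, 1, 1, 0] (s j)

/-- The phase-flip part of a word of Pauli labels. -/
def signPart (s : Fin n → Fin 4) : Fin n → Fin 2 := fun j => ![0, 0, 1, 1] (s j)

theorem ne_zero_of_flipPart_eq_zero {s : Fin n → Fin 4} (hs : s ≠ 0) (h : flipPart s = 0) :
    signPart s ≠ 0 := by
  intro h'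
  apply hs
  funext j
  have h1 := congrFun h j
  have h2 := congrFun h' j
  simp only [flipPart, signPart, Pi.zero_apply] at h1 h2 ⊢
  generalize s j = t at *
  fin_cases t <;> simp_all

theorem exists_pauli_eq (t : Fin 4) : ∃ ω : ℂ, ‖ω‖ = 1 ∧ ∀ x y : Fin 2, pauli t x y =
    if y = x + ![0, 1, 1, 0] t then ω * bitSign (![0, 0, 1, 1] t) x else 0 := by
  fin_cases t
  · refine ⟨1, by simp, fun x y => ?_⟩
    fin_cases x <;> fin_cases y <;> simp [pauli, bitSign]
  · refine ⟨1, by simp, fun x y => ?_⟩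
    fin_cases x <;> fin_cases y <;> simp [pauli, bitSign]
  · refine ⟨-Complex.I, by simp, fun x y => ?_⟩
    fin_cases x <;> fin_cases y <;> simp [pauli, bitSign]
  · refine ⟨1, by simp, fun x y => ?_⟩
    fin_cases x <;> fin_cases y <;> simp [pauli, bitSign]

theorem exists_errorOp_eq (s : Fin n → Fin 4) : ∃ ω : ℂ, ‖ω‖ = 1 ∧ ∀ x y, errorOp s x y =
    if y = x + flipPart s then ω * wordSign (signPart s) x else 0 := by
  choose ω hω h using exists_pauli_eq
  refine ⟨∏ j, ω (s j), by simp [norm_prod, hω], fun x y => ?_⟩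
  simp only [errorOp, of_apply, h]
  split_ifs with hy
  · rw [wordSign, ← Finset.prod_mul_distrib]
    refine Finset.prod_congr rfl fun j _ => ?_
    exact if_pos (congrFun hy j)
  · obtain ⟨j, hj⟩ := Function.ne_iff.mp hy
    exact Finset.prod_eq_zero (Finset.mem_univ j) (if_neg hj)

theorem word_add_self (x : Fin n → Fin 2) : x + x = 0 := by
  funext j
  simp only [Pi.add_apply, Pi.zero_apply]
  generalize x j = t
  fin_cases t <;> rfl

theorem word_add_eq_zero {x y : Fin n → Fin 2} : x + y = 0 ↔ y = x := by
  constructor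
  · intro h
    have := congrArg (x + ·) h
    simpa [← add_assoc, word_add_self] using this
  · rintro rfl
    exact word_add_self _

/-! ### Codes spanned by graph states -/

/-- A symmetric matrix `M` over `𝔽₂` and a set `C` of words define a quantum code of dimension
`|C|`, spanned by graph states. -/
theorem exists_graph_code (M : Matrix (Fin n) (Fin n) (Fin 2)) (hM : M.IsSymm)
    (C : Finset (Fin n → Fin 2)) :
    ∃ Q : Submodule ℂ (Qubits n), Module.finrank ℂ Q = C.card ∧ ∀ s : Fin n → Fin 4,
      (errorOp s * proj Q * (errorOp s).conjTranspose * proj Q).trace.re =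
        ∑ c : C, ∑ d : C,
          if (c : Fin n → Fin 2) + d + (signPart s + M *ᵥ flipPart s) = 0 then 1 else 0 := by
  obtain ⟨φ, hφ, hadd⟩ := exists_quadratic_phase M hM
  have hstar : ∀ x, star (φ x) * φ x = 1 := fun x => by
    rw [Complex.star_def, mul_comm, Complex.mul_conj, Complex.normSq_eq_norm_sq, hφ]
    simp
  let r : ℝ := (√(2 ^ n))⁻¹
  have hr : (r : ℂ) * r * 2 ^ n = 1 := by
    have h : r * r * 2 ^ n = 1 := by
      have h2 : √((2 : ℝ) ^ n) * √(2 ^ n) = 2 ^ n := Real.mul_self_sqrt (by positivity)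
      simp only [r]
      rw [← mul_inv, h2, inv_mul_cancel₀ (by positivity)]
    exact_mod_cast h
  -- The columns are the normalized graph states: the quadratic phase times a character.
  -- Orthonormality is orthogonality of characters.
  let V : Matrix (Fin n → Fin 2) C ℂ := of fun x c => r * φ x * wordSign c.1 x
  have hVstar : ∀ c x, Vᴴ c x = r * star (φ x) * wordSign c.1 x := fun c x => by
    simp [V, conjTranspose_apply, star_wordSign, mul_comm]
  have hV : Vᴴ * V = 1 := by
    ext c d
    rw [mul_apply]
    have : ∀ x, Vᴴ c x * V x d = r * r * wordSign (c.1 + d.1) x := fun x => by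
      rw [hVstar, wordSign_add_left]
      simp only [V, of_apply]
      linear_combination (r : ℂ) * r * wordSign c.1 x * wordSign d.1 x * hstar x
    simp only [this, ← Finset.mul_sum, sum_wordSign, word_add_eq_zero, one_apply]
    by_cases hcd : c = d
    · subst hcd
      simp [hr]
    · rw [if_neg hcd, if_neg (fun h => hcd (Subtype.ext h.symm)), mul_zero]
  obtain ⟨Q, hQ, hproj⟩ := exists_proj_eq_mul_conjTranspose V hV
  refine ⟨Q, by rw [hQ, Fintype.card_coe], fun s => ?_⟩
  rw [hproj, re_trace_compression]
  refine Finset.sum_congr rfl fun c _ => Finset.sum_congr rfl fun d _ => ?_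
  obtain ⟨ω, hω, hE⟩ := exists_errorOp_eq s
  set a := flipPart s
  set b := signPart s
  -- The phase law at `x + a` turns the bit flip into the extra character `M *ᵥ a`, so the entry is
  -- a unimodular scalar times the average of one character.
  have hentry : (Vᴴ * errorOp s * V) c d = ω * φ a * wordSign d.1 a * (r * r *
      ∑ x, wordSign (c.1 + d.1 + (b + M *ᵥ a)) x) := by
    rw [Matrix.mul_assoc, mul_apply, Finset.mul_sum, Finset.mul_sum]
    refine Finset.sum_congr rfl fun x _ => ?_
    rw [mul_apply]
    simp only [hE, ite_mul, zero_mul, Finset.sum_ite_eq', Finset.mem_univ, if_true]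
    rw [hVstar]
    simp only [V, of_apply, hadd, wordSign_add_left, wordSign_add_right]
    linear_combination r * r * ω * φ a * wordSign c.1 x * wordSign d.1 x * wordSign d.1 a
      * wordSign b x * wordSign (M *ᵥ a) x * hstar x
  rw [hentry, sum_wordSign]
  split_ifs with h
  · rw [hr, mul_one, norm_mul, norm_mul, hω, hφ, norm_wordSign]
    norm_num
  · simp

end QuantumErrorDetection

end
-- Random symmetric matrices and random parity checks
noncomputable section

namespace QuantumErrorDetection

open Matrix
open scoped Fin.CommRing

section Fibers

variable {G A : Type*} [AddCommGroup G] [AddCommGroup A] [Fintype G] [Fintype A] [DecidableEq A]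

theorem card_fiber_mul_of_surjective (f : G →+ A) (hf : Function.Surjective f) (v : A) :
    (Finset.univ.filter fun g => f g = v).card * Fintype.card A = Fintype.card G := by
  have h := Finset.card_eq_sum_card_fiberwise (f := f) (s := Finset.univ) (t := Finset.univ)
    (fun _ _ => Finset.mem_univ _)
  rw [Finset.card_univ] at h
  rw [h, Finset.sum_congr rfl fun w _ =>
    AddMonoidHom.card_fiber_eq_of_mem_range f (hf w) (hf v), Finset.sum_const, smul_eq_mul,
    Finset.card_univ, mul_comm]

/-- Every fibre is empty or a coset of the kernel. -/
theorem card_le_card_kernel_mul (f : G →+ A) :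
    Fintype.card G ≤ (Finset.univ.filter fun g => f g = 0).card * Fintype.card A := by
  have h := Finset.card_eq_sum_card_fiberwise (f := f) (s := Finset.univ) (t := Finset.univ)
    (fun _ _ => Finset.mem_univ _)
  rw [Finset.card_univ] at h
  rw [h, mul_comm, ← Finset.card_univ (α := A), ← smul_eq_mul]
  refine Finset.sum_le_card_nsmul _ _ _ fun w _ => ?_
  by_cases hw : w ∈ Set.range f
  · exact (AddMonoidHom.card_fiber_eq_of_mem_range f hw ⟨0, map_zero f⟩).le
  · rw [Finset.filter_eq_empty_iff.mpr fun g _ hg => hw ⟨g, hg⟩]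
    simp

end Fibers

variable {n m : ℕ}

/-- The symmetric matrix with the given entries. -/
def symmMatrix (t : Sym2 (Fin n) → Fin 2) : Matrix (Fin n) (Fin n) (Fin 2) :=
  of fun i j => t s(i, j)

theorem symmMatrix_isSymm (t : Sym2 (Fin n) → Fin 2) : (symmMatrix t).IsSymm := by
  ext i j
  simp [symmMatrix, Sym2.eq_swap]

theorem exists_symmMatrix_eq (M : Matrix (Fin n) (Fin n) (Fin 2)) (hM : M.IsSymm) :
    ∃ t, symmMatrix t = M := by
  refine ⟨Sym2.lift ⟨fun i j => M i j, fun i j => hM.apply j i⟩, ?_⟩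
  ext i j
  simp [symmMatrix]

theorem fin_two_eq_one {t : Fin 2} (h : t ≠ 0) : t = 1 := by
  fin_cases t <;> simp_all

theorem exists_isSymm_mulVec_eq {a : Fin n → Fin 2} (ha : a ≠ 0) (v : Fin n → Fin 2) :
    ∃ M : Matrix (Fin n) (Fin n) (Fin 2), M.IsSymm ∧ M *ᵥ a = v := by
  obtain ⟨j, hj⟩ := Function.ne_iff.mp ha
  have hj1 : a j = 1 := fin_two_eq_one hj
  let e : Fin n → Fin 2 := Pi.single j 1
  have he : e ⬝ᵥ a = 1 := by simp [e, hj1]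
  -- The first two terms send `a` to `v + (v ⬝ᵥ a) • e`; the third cancels the excess in
  -- characteristic 2 and keeps the matrix symmetric.
  refine ⟨vecMulVec v e + vecMulVec e v + vecMulVec ((v ⬝ᵥ a) • e) e, ?_, ?_⟩
  · ext i k
    simp only [transpose_apply, Matrix.add_apply, vecMulVec_apply, Pi.smul_apply, smul_eq_mul]
    rw [mul_comm (v k), mul_comm (e k) (v i), add_comm (e i * v k), mul_right_comm]
  · have h : ∀ u w : Fin n → Fin 2, vecMulVec u w *ᵥ a = (w ⬝ᵥ a) • u := fun u w => by
      rw [vecMulVec_mulVec]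
      ext i
      simp [mul_comm]
    rw [add_mulVec, add_mulVec, h, h, h, he, one_smul, one_smul, add_assoc, word_add_self, add_zero]

theorem card_symm_fiber {a : Fin n → Fin 2} (ha : a ≠ 0) (v : Fin n → Fin 2) :
    (Finset.univ.filter fun t => symmMatrix t *ᵥ a = v).card * 2 ^ n =
      Fintype.card (Sym2 (Fin n) → Fin 2) := by
  let f : (Sym2 (Fin n) → Fin 2) →+ (Fin n → Fin 2) :=
    AddMonoidHom.mk' (fun t => symmMatrix t *ᵥ a) fun t u => by
      rw [← add_mulVec]
      rfl
  have hf : Function.Surjective f := fun v => by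
    obtain ⟨M, hM, h⟩ := exists_isSymm_mulVec_eq ha v
    obtain ⟨t, rfl⟩ := exists_symmMatrix_eq M hM
    exact ⟨t, h⟩
  simpa [f] using card_fiber_mul_of_surjective f hf v

theorem card_mulVec_eq_zero {u : Fin n → Fin 2} (hu : u ≠ 0) :
    (Finset.univ.filter fun A : Matrix (Fin m) (Fin n) (Fin 2) => A *ᵥ u = 0).card * 2 ^ m =
      Fintype.card (Matrix (Fin m) (Fin n) (Fin 2)) := by
  obtain ⟨j, hj⟩ := Function.ne_iff.mp hu
  have hj1 : u j = 1 := fin_two_eq_one hj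
  let f : Matrix (Fin m) (Fin n) (Fin 2) →+ (Fin m → Fin 2) :=
    AddMonoidHom.mk' (fun A => A *ᵥ u) fun A A' => add_mulVec A A' u
  have hf : Function.Surjective f := fun v => by
    refine ⟨vecMulVec v (Pi.single j 1), ?_⟩
    change vecMulVec v (Pi.single j 1) *ᵥ u = v
    rw [vecMulVec_mulVec]
    ext i
    simp [hj1]
  simpa [f] using card_fiber_mul_of_surjective f hf 0

theorem card_kernel_ge (A : Matrix (Fin m) (Fin n) (Fin 2)) :
    2 ^ n ≤ (Finset.univ.filter fun x => A *ᵥ x = 0).card * 2 ^ m := by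
  let f : (Fin n → Fin 2) →+ (Fin m → Fin 2) :=
    AddMonoidHom.mk' (fun x => A *ᵥ x) fun x y => mulVec_add A x y
  simpa [f] using card_le_card_kernel_mul f

/-- The number of nonzero Pauli words of weight `i` whose syndrome vanishes. -/
def undetected (t : Sym2 (Fin n) → Fin 2) (A : Matrix (Fin m) (Fin n) (Fin 2)) (i : ℕ) : ℕ :=
  (Finset.univ.filter fun s : Fin n → Fin 4 =>
    weight s = i ∧ A *ᵥ (signPart s + symmMatrix t *ᵥ flipPart s) = 0).card

/-- The number of Pauli words of weight `i`. -/
def weightCount (n i : ℕ) : ℕ := (Finset.univ.filter fun s : Fin n → Fin 4 => weight s = i).card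

theorem exists_code_Bperp_le (t : Sym2 (Fin n) → Fin 2) (A : Matrix (Fin m) (Fin n) (Fin 2))
    {K : ℕ} (hK : 1 ≤ K) (hKm : K * 2 ^ m ≤ 2 ^ n) :
    ∃ Q : Submodule ℂ (Qubits n), Module.finrank ℂ Q = K ∧
      ∀ i, Bperp Q i ≤ undetected t A i := by
  have hker : K ≤ (Finset.univ.filter fun x => A *ᵥ x = 0).card :=
    Nat.le_of_mul_le_mul_right (hKm.trans (card_kernel_ge A)) (by positivity)
  obtain ⟨C, hCsub, hC⟩ := Finset.exists_subset_card_eq hker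
  obtain ⟨Q, hQ, htr⟩ := exists_graph_code (symmMatrix t) (symmMatrix_isSymm t) C
  refine ⟨Q, hQ.trans hC, fun i => ?_⟩
  have hK0 : (0 : ℝ) < K := by exact_mod_cast hK
  have hbound : ∀ s : Fin n → Fin 4,
      (errorOp s * proj Q * (errorOp s).conjTranspose * proj Q).trace.re ≤
        if A *ᵥ (signPart s + symmMatrix t *ᵥ flipPart s) = 0 then (K : ℝ) else 0 := by
    intro s
    rw [htr]
    set u := signPart s + symmMatrix t *ᵥ flipPart s
    have hmem : ∀ c : C, A *ᵥ c.1 = 0 := fun c => (Finset.mem_filter.mp (hCsub c.2)).2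
    split_ifs with hu
    -- For each `c` the equation determines `d`, so at most `K` pairs contribute.
    · calc _ ≤ ∑ c : C, (1 : ℝ) := by
            refine Finset.sum_le_sum fun c _ => ?_
            rw [Finset.sum_boole]
            norm_cast
            refine Finset.card_le_one.mpr fun d hd d' hd' => ?_
            have h1 := (Finset.mem_filter.mp hd).2
            have h2 := (Finset.mem_filter.mp hd').2
            rw [add_right_comm] at h1 h2
            rw [word_add_eq_zero] at h1 h2
            exact Subtype.ext (h1.trans h2.symm)
        _ = K := by simp [hC]
    · refine (Finset.sum_eq_zero fun c _ => Finset.sum_eq_zero fun d _ => if_neg fun h => hu ?_).le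
      have := congrArg (A *ᵥ ·) h
      simpa [mulVec_add, hmem] using this
  rw [Bperp, hQ, hC]
  calc _ ≤ 1 / (K : ℝ) * ∑ s : Fin n → Fin 4 with weight s = i,
        (if A *ᵥ (signPart s + symmMatrix t *ᵥ flipPart s) = 0 then (K : ℝ) else 0) := by
        gcongr with s _
        exact hbound s
    _ = undetected t A i := by
        rw [← Finset.sum_filter, Finset.filter_filter, Finset.sum_const, nsmul_eq_mul, undetected]
        field_simp

/-- There are two ways to pass. Either `b + Ma` vanishes, which is impossible if `a = 0` (then `b ≠
0`) and has probability `2^(-n) ≤ 2^(-m)` otherwise; or it is nonzero and `A` kills it, with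
conditional probability `2^(-m)`. -/
theorem sum_undetected_indicator_le (hmn : m ≤ n) {s : Fin n → Fin 4} (hs : s ≠ 0) :
    (∑ ω : (Sym2 (Fin n) → Fin 2) × Matrix (Fin m) (Fin n) (Fin 2),
      if ω.2 *ᵥ (signPart s + symmMatrix ω.1 *ᵥ flipPart s) = 0 then (1 : ℝ) else 0) ≤
    Fintype.card ((Sym2 (Fin n) → Fin 2) × Matrix (Fin m) (Fin n) (Fin 2)) * (2 / 2 ^ m) := by
  rw [Fintype.sum_prod_type, Fintype.card_prod]
  set α : ℝ := ((Fintype.card (Sym2 (Fin n) → Fin 2) : ℕ) : ℝ) with hαdef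
  set β : ℝ := ((Fintype.card (Matrix (Fin m) (Fin n) (Fin 2)) : ℕ) : ℝ) with hβdef
  have hα : 0 ≤ α := Nat.cast_nonneg _
  have hβ : 0 ≤ β := Nat.cast_nonneg _
  have hinner : ∀ t : Sym2 (Fin n) → Fin 2, (∑ A : Matrix (Fin m) (Fin n) (Fin 2),
      if A *ᵥ (signPart s + symmMatrix t *ᵥ flipPart s) = 0 then (1 : ℝ) else 0) ≤
      (if signPart s + symmMatrix t *ᵥ flipPart s = 0 then β else 0) + β / 2 ^ m := by
    intro t
    split_ifs with h
    · have : (∑ A : Matrix (Fin m) (Fin n) (Fin 2),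
          if A *ᵥ (signPart s + symmMatrix t *ᵥ flipPart s) = 0 then (1 : ℝ) else 0) = β := by
        simp [h, β]
      rw [this]
      have : 0 ≤ β / 2 ^ m := by positivity
      linarith
    · rw [Finset.sum_boole, zero_add, le_div_iff₀ (by positivity)]
      have := card_mulVec_eq_zero (m := m) h
      rw [hβdef]
      exact_mod_cast this.le
  have houter : (∑ t : Sym2 (Fin n) → Fin 2,
      if signPart s + symmMatrix t *ᵥ flipPart s = 0 then β else 0) ≤ α * (β / 2 ^ m) := by
    by_cases ha : flipPart s = 0
    · have hb := ne_zero_of_flipPart_eq_zero hs ha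
      simp only [ha, mulVec_zero, add_zero, if_neg hb, Finset.sum_const_zero]
      positivity
    · have h1 := card_symm_fiber ha (signPart s)
      have h2 : (Finset.univ.filter fun t => symmMatrix t *ᵥ flipPart s = signPart s) =
          Finset.univ.filter fun t => signPart s + symmMatrix t *ᵥ flipPart s = 0 := by
        ext t
        simp only [Finset.mem_filter, Finset.mem_univ, true_and, word_add_eq_zero]
      rw [h2] at h1
      have h3 : ((Finset.univ.filter fun t =>
          signPart s + symmMatrix t *ᵥ flipPart s = 0).card : ℝ) * 2 ^ n = α := by
        rw [hαdef]
        exact_mod_cast h1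
      rw [← Finset.sum_filter, Finset.sum_const, nsmul_eq_mul, mul_div_assoc', le_div_iff₀
        (by positivity), ← h3]
      have h4 : (2 : ℝ) ^ m ≤ 2 ^ n := pow_le_pow_right₀ (by norm_num) hmn
      have := mul_le_mul_of_nonneg_left h4 (mul_nonneg (Nat.cast_nonneg (α := ℝ)
        (Finset.univ.filter fun t => signPart s + symmMatrix t *ᵥ flipPart s = 0).card) hβ)
      linarith
  calc _ ≤ ∑ t : Sym2 (Fin n) → Fin 2,
        ((if signPart s + symmMatrix t *ᵥ flipPart s = 0 then β else 0) + β / 2 ^ m) :=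
        Finset.sum_le_sum fun t _ => hinner t
    _ = (∑ t : Sym2 (Fin n) → Fin 2,
        if signPart s + symmMatrix t *ᵥ flipPart s = 0 then β else 0) + α * (β / 2 ^ m) := by
        rw [Finset.sum_add_distrib, Finset.sum_const, nsmul_eq_mul, Finset.card_univ]
    _ ≤ α * (β / 2 ^ m) + α * (β / 2 ^ m) := by gcongr
    _ = _ := by push_cast; ring

theorem ne_zero_of_weight_pos {s : Fin n → Fin 4} (h : 1 ≤ weight s) : s ≠ 0 := by
  rintro rfl
  simp [weight] at h

theorem sum_undetected_le (hmn : m ≤ n) {i : ℕ} (hi : 1 ≤ i) :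
    (∑ ω : (Sym2 (Fin n) → Fin 2) × Matrix (Fin m) (Fin n) (Fin 2),
      (undetected ω.1 ω.2 i : ℝ)) ≤
    Fintype.card ((Sym2 (Fin n) → Fin 2) × Matrix (Fin m) (Fin n) (Fin 2)) *
      (2 / 2 ^ m * weightCount n i) := by
  have h : ∀ ω : (Sym2 (Fin n) → Fin 2) × Matrix (Fin m) (Fin n) (Fin 2),
      (undetected ω.1 ω.2 i : ℝ) = ∑ s : Fin n → Fin 4 with weight s = i,
        if ω.2 *ᵥ (signPart s + symmMatrix ω.1 *ᵥ flipPart s) = 0 then (1 : ℝ) else 0 := by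
    intro ω
    rw [Finset.sum_boole, Finset.filter_filter, undetected]
  simp only [h]
  rw [Finset.sum_comm, ← mul_assoc, mul_comm _ (weightCount n i : ℝ), weightCount, ← nsmul_eq_mul]
  refine Finset.sum_le_card_nsmul _ _ _ fun s hs => ?_
  have hw := (Finset.mem_filter.mp hs).2
  exact sum_undetected_indicator_le hmn (ne_zero_of_weight_pos (hw ▸ hi))

/-! ### Selecting one code good at every weight -/

/-- Markov's inequality and the union bound: if each of `|I|` nonnegative functions has mean at
most `μ i`, then at some point each of them is at most `|I| μ i`. -/
theorem exists_forall_le_card_mul {Ω ι : Type*} [Fintype Ω] [Nonempty Ω] (I : Finset ι)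
    (N : Ω → ι → ℝ) (μ : ι → ℝ) (hN : ∀ ω, ∀ i ∈ I, 0 ≤ N ω i) (hμ : ∀ i ∈ I, 0 ≤ μ i)
    (h : ∀ i ∈ I, ∑ ω, N ω i ≤ Fintype.card Ω * μ i) :
    ∃ ω, ∀ i ∈ I, N ω i ≤ I.card * μ i := by
  have hsum : ∑ ω, ∑ i ∈ I, N ω i / μ i ≤ ∑ _ω : Ω, (I.card : ℝ) := by
    rw [Finset.sum_comm, Finset.sum_const, nsmul_eq_mul, Finset.card_univ, mul_comm,
      ← nsmul_eq_mul]
    refine Finset.sum_le_card_nsmul _ _ _ fun i hi => ?_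
    rw [← Finset.sum_div]
    -- If `μ i = 0` the quotient is 0 by convention; that index is recovered below, where a zero sum
    -- forces every term to vanish.
    rcases (hμ i hi).eq_or_lt with h0 | h0
    · rw [← h0, div_zero]
      positivity
    · rw [div_le_iff₀ h0]
      exact h i hi
  obtain ⟨ω, -, hω⟩ := Finset.exists_le_of_sum_le Finset.univ_nonempty hsum
  refine ⟨ω, fun i hi => ?_⟩
  rcases (hμ i hi).eq_or_lt with h0 | h0
  · have h1 := h i hi
    rw [← h0, mul_zero] at h1
    have h2 := Finset.single_le_sum (f := fun ω => N ω i) (fun ω _ => hN ω i hi)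
      (Finset.mem_univ ω)
    rw [← h0, mul_zero]
    exact h2.trans h1
  · rw [← div_le_iff₀ h0]
    exact (Finset.single_le_sum (f := fun i => N ω i / μ i)
      (fun i hi => div_nonneg (hN ω i hi) (hμ i hi)) hi).trans hω

theorem exists_code_forall_Bperp_le {K : ℕ} (hK : 1 ≤ K) (hKn : K ≤ 2 ^ n) :
    ∃ Q : Submodule ℂ (Qubits n), Module.finrank ℂ Q = K ∧ ∀ i ∈ Finset.Icc 1 n,
      Bperp Q i ≤ n * (4 * K / 2 ^ n * weightCount n i) ∧
      (n * (4 * K / 2 ^ n * weightCount n i : ℝ) < 1 → Bperp Q i ≤ 0) := by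
  -- The largest `m` with `K * 2 ^ m ≤ 2 ^ n`; rounding to a power of 2 loses at most a factor 2,
  -- hence `4 * K / 2 ^ n` below.
  let m := Nat.log 2 (2 ^ n / K)
  have hdiv : 2 ^ n / K ≠ 0 := (Nat.div_pos hKn hK).ne'
  have hm1 : 2 ^ m ≤ 2 ^ n / K := Nat.pow_log_le_self 2 hdiv
  have hm2 : 2 ^ n / K < 2 ^ (m + 1) := Nat.lt_pow_succ_log_self (by norm_num) _
  have hKm : K * 2 ^ m ≤ 2 ^ n := by
    rw [mul_comm]
    exact (Nat.le_div_iff_mul_le hK).mp hm1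
  have hmn : m ≤ n := (Nat.pow_le_pow_iff_right (a := 2) (by norm_num)).mp
    (hm1.trans (Nat.div_le_self _ _))
  have hq : (2 : ℝ) / 2 ^ m ≤ 4 * K / 2 ^ n := by
    have h : 2 ^ n < 2 ^ (m + 1) * K := (Nat.div_lt_iff_lt_mul hK).mp hm2
    have h' : (2 : ℝ) ^ n < 2 ^ (m + 1) * K := by exact_mod_cast h
    rw [div_le_div_iff₀ (by positivity) (by positivity)]
    rw [pow_succ] at h'
    linarith
  obtain ⟨ω, hω⟩ := exists_forall_le_card_mul (Finset.Icc 1 n)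
    (fun ω : (Sym2 (Fin n) → Fin 2) × Matrix (Fin m) (Fin n) (Fin 2) => fun i =>
      (undetected ω.1 ω.2 i : ℝ))
    (fun i => 2 / 2 ^ m * weightCount n i) (fun _ _ _ => Nat.cast_nonneg _)
    (fun _ _ => by positivity) (fun i hi => sum_undetected_le hmn (Finset.mem_Icc.mp hi).1)
  obtain ⟨Q, hQ, hB⟩ := exists_code_Bperp_le ω.1 ω.2 hK hKm
  refine ⟨Q, hQ, fun i hi => ?_⟩
  have hle : (undetected ω.1 ω.2 i : ℝ) ≤ n * (4 * K / 2 ^ n * weightCount n i) := by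
    have h := hω i hi
    rw [Nat.card_Icc, Nat.add_sub_cancel] at h
    refine h.trans ?_
    gcongr
  refine ⟨(hB i).trans hle, fun hlt => (hB i).trans ?_⟩
  -- Expurgation: a natural number below 1 is 0.
  have : undetected ω.1 ω.2 i < 1 := by exact_mod_cast hle.trans_lt hlt
  simp [Nat.lt_one_iff.mp this]

/-! ### Counting Pauli words by weight -/

theorem weight_le (s : Fin n → Fin 4) : weight s ≤ n :=
  (Finset.card_filter_le _ _).trans (by simp)

theorem sum_weightCount_mul (x : ℝ) :
    ∑ i ∈ Finset.range (n + 1), weightCount n i * ((x / 3) ^ i * (1 - x) ^ (n - i)) = 1 := by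
  let g : Fin 4 → ℝ := fun τ => if τ ≠ 0 then x / 3 else 1 - x
  have hg : ∑ τ, g τ = 1 := by
    simp [g, Fin.sum_univ_four]
    ring
  have hprod : ∀ s : Fin n → Fin 4,
      ∏ j, g (s j) = (x / 3) ^ weight s * (1 - x) ^ (n - weight s) := by
    intro s
    have hc := Finset.card_filter_add_card_filter_not (s := (Finset.univ : Finset (Fin n)))
      (p := fun j => s j ≠ 0)
    rw [Finset.card_univ, Fintype.card_fin] at hc
    simp only [g]
    rw [Finset.prod_ite, Finset.prod_const, Finset.prod_const, weight]
    congr 2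
    omega
  have hpow : ∑ s : Fin n → Fin 4, ∏ j, g (s j) = 1 := by
    have := Finset.prod_univ_sum (fun _ : Fin n => (Finset.univ : Finset (Fin 4)))
      (fun _ τ => g τ)
    rw [Fintype.piFinset_univ] at this
    rw [← this, hg]
    simp
  refine Eq.trans ?_ hpow
  rw [← Finset.sum_fiberwise_of_maps_to (s := Finset.univ) (t := Finset.range (n + 1))
    (g := weight) (fun s _ => Finset.mem_range.mpr (Nat.lt_succ_of_le (weight_le s)))]
  refine Finset.sum_congr rfl fun i _ => ?_
  rw [weightCount, ← nsmul_eq_mul, ← Finset.sum_const]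
  refine Finset.sum_congr rfl fun s hs => ?_
  rw [hprod, (Finset.mem_filter.mp hs).2]

/-- One term of a probability distribution is at most 1. It is applied with `x = δ`, not with the
channel parameter, to bound `weightCount`. -/
theorem weightCount_mul_le_one {x : ℝ} (h0 : 0 ≤ x) (h1 : x ≤ 1) {i : ℕ} (hi : i ≤ n) :
    weightCount n i * ((x / 3) ^ i * (1 - x) ^ (n - i)) ≤ 1 := by
  have h2 : 0 ≤ 1 - x := by linarith
  refine le_of_le_of_eq ?_ (sum_weightCount_mul (n := n) x)
  exact Finset.single_le_sum
    (f := fun i => weightCount n i * ((x / 3) ^ i * (1 - x) ^ (n - i)))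
    (fun i _ => by positivity) (Finset.mem_range.mpr (Nat.lt_succ_of_le hi))

theorem B_nonneg (Q : Submodule ℂ (Qubits n)) (i : ℕ) : 0 ≤ B Q i := by
  unfold B
  positivity

end QuantumErrorDetection

end
-- From finite length to the exponent
noncomputable section

namespace QuantumErrorDetection

open Filter Topology

/-- Isolates what the estimates need from the code: any sequence `b` obeying the two bounds may
replace `Bperp`, since `B` is nonnegative and only lowers the sum. -/
theorem minPue_le {n K : ℕ} (hK : 1 ≤ K) (hKn : K ≤ 2 ^ n) {p c : ℝ} (hp0 : 0 ≤ p) (hp1 : p ≤ 1)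
    (hc : ∀ b : ℕ → ℝ, (∀ i ∈ Finset.Icc 1 n,
        b i ≤ n * (4 * K / 2 ^ n * weightCount n i) ∧
        (n * (4 * K / 2 ^ n * weightCount n i : ℝ) < 1 → b i ≤ 0)) →
      ∑ i ∈ Finset.Icc 1 n, b i * ((p / 3) ^ i * (1 - p) ^ (n - i)) ≤ c) :
    minPue n K p ≤ ENNReal.ofReal c := by
  obtain ⟨Q, hQ, hB⟩ := exists_code_forall_Bperp_le hK hKn
  refine (iInf₂_le Q hQ).trans (ENNReal.ofReal_le_ofReal ?_)
  refine le_trans ?_ (hc _ hB)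
  have h1p : 0 ≤ 1 - p := by linarith
  refine Finset.sum_le_sum fun i _ => ?_
  rw [mul_assoc]
  gcongr
  linarith [B_nonneg Q i]

/-- Constants and powers of `n` change the exponent only by `O(log n / n)`. -/
theorem le_lowerExponent {R p α A b : ℝ} (hA : 0 < A)
    (h : ∀ n : ℕ, 1 ≤ n → minPue n ⌈(2 : ℝ) ^ (R * n)⌉₊ p ≤
      ENNReal.ofReal (A * (n : ℝ) ^ b * 4 ^ (-(α * n)))) :
    (α : EReal) ≤ lowerExponent R p := by
  have h4 : 0 < Real.log 4 := Real.log_pos (by norm_num)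
  let g : ℕ → ℝ := fun n => α - (Real.log A / Real.log 4 * (n : ℝ)⁻¹ +
    b / Real.log 4 * (Real.log n / n))
  have hg : Tendsto g atTop (𝓝 α) := by
    have h1 : Tendsto (fun n : ℕ => ((n : ℝ))⁻¹) atTop (𝓝 0) := tendsto_inv_atTop_nhds_zero_nat
    have h2 : Tendsto (fun n : ℕ => Real.log n / (n : ℝ)) atTop (𝓝 0) :=
      (Real.isLittleO_log_id_atTop.tendsto_div_nhds_zero).comp tendsto_natCast_atTop_atTop
    have h3 := ((h1.const_mul (Real.log A / Real.log 4)).add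
      (h2.const_mul (b / Real.log 4))).const_sub α
    simpa using h3
  have hg' : Tendsto (fun n => (g n : EReal)) atTop (𝓝 (α : EReal)) :=
    (continuous_coe_real_ereal.tendsto α).comp hg
  rw [← hg'.liminf_eq, lowerExponent]
  refine liminf_le_liminf ?_
  filter_upwards [eventually_ge_atTop 1] with n hn
  have hn0 : (0 : ℝ) < n := by exact_mod_cast hn
  have hpos : 0 < A * (n : ℝ) ^ b * (4 : ℝ) ^ (-(α * n)) := by positivity
  have hlog : ENNReal.log (minPue n ⌈(2 : ℝ) ^ (R * n)⌉₊ p) ≤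
      ((Real.log A + b * Real.log n - α * n * Real.log 4 : ℝ) : EReal) := by
    refine (ENNReal.log_monotone (h n hn)).trans ?_
    rw [ENNReal.log_ofReal_of_pos hpos, EReal.coe_le_coe_iff,
      Real.log_mul (by positivity) (by positivity), Real.log_mul (by positivity) (by positivity),
      Real.log_rpow hn0, Real.log_rpow (by norm_num)]
    linarith
  have hx : (0 : ℝ) < n * Real.log 4 := by positivity
  have hdiv := EReal.div_le_div_right_of_nonneg (c := ((n * Real.log 4 : ℝ) : EReal))
    (by exact_mod_cast hx.le) hlog
  have hval : (g n : EReal) =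
      -(((Real.log A + b * Real.log n - α * n * Real.log 4 : ℝ) : EReal) /
        ((n * Real.log 4 : ℝ) : EReal)) := by
    rw [← EReal.coe_div, ← EReal.coe_neg, EReal.coe_eq_coe_iff]
    simp only [g]
    field_simp
    ring
  rw [hval, exponent, EReal.neg_le_neg_iff]
  exact hdiv

theorem four_mul_ceil_div_le {R : ℝ} (hR0 : 0 ≤ R) (n : ℕ) :
    4 * (⌈(2 : ℝ) ^ (R * n)⌉₊ : ℝ) / 2 ^ n ≤ 8 * 4 ^ (-((1 - R) / 2 * n)) := by
  have h1 : (1 : ℝ) ≤ 2 ^ (R * n) := Real.one_le_rpow (by norm_num) (by positivity)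
  have h2 : (⌈(2 : ℝ) ^ (R * n)⌉₊ : ℝ) < 2 ^ (R * n) + 1 := Nat.ceil_lt_add_one (by positivity)
  have h3 : (4 : ℝ) ^ (-((1 - R) / 2 * n)) = 2 ^ (R * n) / 2 ^ n := by
    rw [show (4 : ℝ) = 2 ^ (2 : ℝ) by norm_num, ← Real.rpow_mul (by norm_num),
      ← Real.rpow_natCast 2 n, ← Real.rpow_sub (by norm_num)]
    congr 1
    ring
  rw [h3, mul_div_assoc']
  refine div_le_div_of_nonneg_right ?_ (by positivity)
  linarith

theorem one_le_ceil_rpow {R : ℝ} (n : ℕ) : 1 ≤ ⌈(2 : ℝ) ^ (R * n)⌉₊ :=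
  Nat.one_le_ceil_iff.mpr (by positivity)

theorem ceil_rpow_le {R : ℝ} (hR1 : R ≤ 1) (n : ℕ) : ⌈(2 : ℝ) ^ (R * n)⌉₊ ≤ 2 ^ n := by
  rw [Nat.ceil_le]
  push_cast
  rw [← Real.rpow_natCast]
  refine Real.rpow_le_rpow_of_exponent_le (by norm_num) ?_
  exact mul_le_of_le_one_left (Nat.cast_nonneg n) hR1

theorem half_one_sub_le_lowerExponent {R p : ℝ} (hR0 : 0 ≤ R) (hR1 : R ≤ 1) (hp0 : 0 ≤ p)
    (hp1 : p ≤ 1) : (((1 - R) / 2 : ℝ) : EReal) ≤ lowerExponent R p := by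
  refine le_lowerExponent (A := 8) (b := 1) (by norm_num) fun n hn => ?_
  refine minPue_le (one_le_ceil_rpow n) (ceil_rpow_le hR1 n) hp0 hp1 fun b hb => ?_
  set q : ℝ := 4 * (⌈(2 : ℝ) ^ (R * n)⌉₊ : ℝ) / 2 ^ n
  have hq0 : 0 ≤ q := by positivity
  have h1p : 0 ≤ 1 - p := by linarith
  calc ∑ i ∈ Finset.Icc 1 n, b i * ((p / 3) ^ i * (1 - p) ^ (n - i))
      ≤ ∑ i ∈ Finset.Icc 1 n,
          n * q * (weightCount n i * ((p / 3) ^ i * (1 - p) ^ (n - i))) := by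
        refine Finset.sum_le_sum fun i hi => ?_
        refine (mul_le_mul_of_nonneg_right (hb i hi).1 (by positivity)).trans_eq ?_
        ring
    _ = n * q * ∑ i ∈ Finset.Icc 1 n,
          (weightCount n i * ((p / 3) ^ i * (1 - p) ^ (n - i))) := by rw [Finset.mul_sum]
    _ ≤ n * q * ∑ i ∈ Finset.range (n + 1),
          (weightCount n i * ((p / 3) ^ i * (1 - p) ^ (n - i))) := by
        refine mul_le_mul_of_nonneg_left ?_ (by positivity)
        refine Finset.sum_le_sum_of_subset_of_nonneg (fun i hi => ?_) (fun i _ _ => by positivity)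
        have := Finset.mem_Icc.mp hi
        exact Finset.mem_range.mpr (by omega)
    _ = n * q := by rw [sum_weightCount_mul, mul_one]
    _ ≤ n * (8 * 4 ^ (-((1 - R) / 2 * n))) := by
        gcongr
        exact four_mul_ceil_div_le hR0 n
    _ = _ := by rw [Real.rpow_one]; ring

/-! ### The quaternary entropy function and its inverse -/

theorem T_mul_log (x y : ℝ) : T 4 x y * Real.log 4 =
    x * Real.log 3 - x * Real.log y - (1 - x) * Real.log (1 - y) := by
  have h4 : Real.log 4 ≠ 0 := (Real.log_pos (by norm_num)).ne'
  simp only [T, Real.logb]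
  rw [show (4 : ℝ) - 1 = 3 by norm_num]
  field_simp

theorem H_eq_qaryEntropy (x : ℝ) : H 4 x = Real.qaryEntropy 4 x / Real.log 4 := by
  have h4 : Real.log 4 ≠ 0 := (Real.log_pos (by norm_num)).ne'
  rw [eq_div_iff h4, H, T_mul_log, Real.qaryEntropy, Real.binEntropy]
  simp only [Real.log_inv]
  norm_num
  ring

theorem H_zero : H 4 0 = 0 := by simp [H, T]

theorem H_three_quarters : H 4 (3 / 4) = 1 := by
  have h4 : Real.log 4 ≠ 0 := (Real.log_pos (by norm_num)).ne'
  have h : H 4 (3 / 4) * Real.log 4 = 1 * Real.log 4 := by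
    rw [H, T_mul_log, show (1 : ℝ) - 3 / 4 = 4⁻¹ by norm_num, Real.log_inv,
      Real.log_div (by norm_num) (by norm_num)]
    ring
  exact mul_right_cancel₀ h4 h

theorem half_lt_H_one : 1 / 2 < H 4 1 := by
  have h4 : 0 < Real.log 4 := Real.log_pos (by norm_num)
  have h : H 4 1 * Real.log 4 = Real.log 3 := by
    rw [H, T_mul_log]
    simp
  have h2 : Real.log 4 = 2 * Real.log 2 := by
    rw [show (4 : ℝ) = 2 ^ 2 by norm_num, Real.log_pow]
    norm_num
  have h3 : Real.log 2 < Real.log 3 := Real.log_lt_log (by norm_num) (by norm_num)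
  nlinarith

theorem H_strictMonoOn : StrictMonoOn (H 4) (Set.Icc 0 (3 / 4)) := by
  have h4 : 0 < Real.log 4 := Real.log_pos (by norm_num)
  have h := Real.qaryEntropy_strictMonoOn (q := 4) (by norm_num)
  intro x hx y hy hxy
  rw [H_eq_qaryEntropy, H_eq_qaryEntropy]
  refine div_lt_div_of_pos_right (h ?_ ?_ hxy) h4
  · convert hx using 2; norm_num
  · convert hy using 2; norm_num

theorem H_strictAntiOn : StrictAntiOn (H 4) (Set.Icc (3 / 4) 1) := by
  have h4 : 0 < Real.log 4 := Real.log_pos (by norm_num)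
  have h := Real.qaryEntropy_strictAntiOn (q := 4) (by norm_num)
  intro x hx y hy hxy
  rw [H_eq_qaryEntropy, H_eq_qaryEntropy]
  refine div_lt_div_of_pos_right (h ?_ ?_ hxy) h4
  · convert hx using 2; norm_num
  · convert hy using 2; norm_num

theorem H_continuous : Continuous (H 4) := by
  have : H 4 = fun x => Real.qaryEntropy 4 x / Real.log 4 := funext H_eq_qaryEntropy
  rw [this]
  exact Real.qaryEntropy_continuous.div_const _

theorem Hinv_spec {y : ℝ} (h0 : 0 ≤ y) (h1 : y ≤ 1) :
    Hinv 4 y ∈ Set.Icc (0 : ℝ) (3 / 4) ∧ H 4 (Hinv 4 y) = y := by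
  have hI : Set.Icc (0 : ℝ) (1 - 1 / 4) = Set.Icc 0 (3 / 4) := by norm_num
  have hex : ∃ x ∈ Set.Icc (0 : ℝ) (1 - 1 / 4), H 4 x = y := by
    rw [hI]
    have := intermediate_value_Icc (show (0 : ℝ) ≤ 3 / 4 by norm_num) H_continuous.continuousOn
    rw [H_zero, H_three_quarters] at this
    exact this ⟨h0, h1⟩
  exact ⟨hI ▸ Function.invFunOn_mem hex, Function.invFunOn_eq hex⟩

/-- On the decreasing branch beyond `3 / 4`, `H 4` stays at least `H 4 1 = log₄ 3 > 1 / 2`, so a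
small entropy puts `p` on the increasing branch. -/
theorem le_three_quarters_of_H_le {p : ℝ} (hp1 : p ≤ 1) (h : H 4 p ≤ 1 / 2) : p ≤ 3 / 4 := by
  by_contra! hp
  have h1 : H 4 1 ≤ H 4 p := H_strictAntiOn.antitoneOn ⟨hp.le, hp1⟩ ⟨by norm_num, le_rfl⟩ hp1
  linarith [half_lt_H_one]

/-! ### The expurgated bound -/

/-- The logarithmic form of the Chernoff bound at the Gilbert–Varshamov point. -/
theorem log_tail_bound {δ p r ℓ β lw lq ln h l8 i n : ℝ}
    (hr : r = Real.log 3 + Real.log (1 - δ) - Real.log δ)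
    (hℓ : ℓ = Real.log δ + Real.log (1 - p) - Real.log (1 - δ) - Real.log p)
    (hh : h = δ * Real.log 3 - δ * Real.log δ - (1 - δ) * Real.log (1 - δ))
    (hβ : β * r = ℓ) (hβ0 : 0 ≤ β)
    (hw : lw + (i * (Real.log δ - Real.log 3) + (n - i) * Real.log (1 - δ)) ≤ 0)
    (hq : lq ≤ l8 - n * h) (hone : 0 ≤ ln + (lq + lw)) :
    lq + lw + (i * (Real.log p - Real.log 3) + (n - i) * Real.log (1 - p)) ≤
      l8 + β * (l8 + ln) -
        n * (δ * Real.log 3 - δ * Real.log p - (1 - δ) * Real.log (1 - p)) := by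
  have h1 : lw ≤ n * h + (i - δ * n) * r := by
    rw [hr, hh]
    linarith
  -- Survival of weight `i` (`hone`) limits how far `i` can lie below `δ * n`.
  have h2 : (δ * n - i) * r ≤ l8 + ln := by linarith
  have h3 : (δ * n - i) * ℓ ≤ β * (l8 + ln) := by
    rw [← hβ]
    have := mul_le_mul_of_nonneg_left h2 hβ0
    linarith
  -- The tilted bound exceeds its value at `i = δ * n` by exactly `(δ * n - i) * ℓ`, which `h3`
  -- controls.
  have h4 : lq + lw ≤ l8 + (i - δ * n) * r := by linarith
  rw [hr] at h4
  rw [hℓ] at h3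
  linarith

theorem T_le_lowerExponent {R p δ : ℝ} (hR0 : 0 ≤ R) (hR1 : R ≤ 1) (hp0 : 0 < p) (hpδ : p ≤ δ)
    (hδ : δ < 3 / 4) (hH : H 4 δ = (1 - R) / 2) : (T 4 δ p : EReal) ≤ lowerExponent R p := by
  have hδ0 : 0 < δ := hp0.trans_le hpδ
  have h1δ : 0 < 1 - δ := by linarith
  have h1p : 0 < 1 - p := by linarith
  set r := Real.log 3 + Real.log (1 - δ) - Real.log δ with hr
  set ℓ := Real.log δ + Real.log (1 - p) - Real.log (1 - δ) - Real.log p with hℓ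
  have hr0 : 0 < r := by
    rw [hr, ← Real.log_mul (by norm_num) h1δ.ne', sub_pos]
    exact Real.log_lt_log hδ0 (by linarith)
  have hℓ0 : 0 ≤ ℓ := by
    have h1 := Real.log_le_log hp0 hpδ
    have h2 := Real.log_le_log h1δ (show 1 - δ ≤ 1 - p by linarith)
    rw [hℓ]
    linarith
  set β := ℓ / r
  have hβ0 : 0 ≤ β := by positivity
  have hβ : β * r = ℓ := div_mul_cancel₀ _ hr0.ne'
  -- Two powers of `n` come from the union bound and the number of weights; `(8 * n) ^ β` is the
  -- cost of weights slightly below `δ * n`.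
  refine le_lowerExponent (A := 8 * 8 ^ β) (b := 2 + β) (by positivity) fun n hn => ?_
  have hn0 : (0 : ℝ) < n := by exact_mod_cast hn
  refine minPue_le (one_le_ceil_rpow n) (ceil_rpow_le hR1 n) hp0.le (by linarith) fun b hb => ?_
  set q : ℝ := 4 * (⌈(2 : ℝ) ^ (R * n)⌉₊ : ℝ) / 2 ^ n
  have hK := one_le_ceil_rpow (R := R) n
  have hK0 : (0 : ℝ) < ⌈(2 : ℝ) ^ (R * n)⌉₊ := by exact_mod_cast hK
  have hq0 : 0 < q := by positivity
  have hlq : Real.log q ≤ Real.log 8 -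
      n * (δ * Real.log 3 - δ * Real.log δ - (1 - δ) * Real.log (1 - δ)) := by
    have h1 := Real.log_le_log hq0 (four_mul_ceil_div_le hR0 n)
    rw [← hH, Real.log_mul (by norm_num) (by positivity), Real.log_rpow (by norm_num)] at h1
    rw [← T_mul_log, ← H]
    linarith
  have hterm : ∀ i ∈ Finset.Icc 1 n, b i * ((p / 3) ^ i * (1 - p) ^ (n - i)) ≤
      n * (8 * (8 * n) ^ β * 4 ^ (-(T 4 δ p * n))) := by
    intro i hi
    obtain ⟨hbi, hbi0⟩ := hb i hi
    have hin := (Finset.mem_Icc.mp hi).2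
    rcases lt_or_ge (n * (q * weightCount n i)) 1 with hlt | hge
    · refine (mul_nonpos_of_nonpos_of_nonneg (hbi0 hlt) (by positivity)).trans (by positivity)
    have hw0 : (0 : ℝ) < weightCount n i := by
      rcases (Nat.cast_nonneg (α := ℝ) (weightCount n i)).eq_or_lt with h0 | h0
      · rw [← h0] at hge
        norm_num at hge
      · exact h0
    have hcast : ((n - i : ℕ) : ℝ) = n - i := Nat.cast_sub hin
    have hlw : Real.log (weightCount n i) +
        (i * (Real.log δ - Real.log 3) + (n - i) * Real.log (1 - δ)) ≤ 0 := by
      have h1 := Real.log_le_log (by positivity)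
        (weightCount_mul_le_one hδ0.le (by linarith) hin)
      rwa [Real.log_one, Real.log_mul hw0.ne' (by positivity),
        Real.log_mul (by positivity) (by positivity), Real.log_pow, Real.log_pow,
        Real.log_div hδ0.ne' (by norm_num), hcast] at h1
    have hone : 0 ≤ Real.log n + (Real.log q + Real.log (weightCount n i)) := by
      rw [← Real.log_mul hq0.ne' hw0.ne', ← Real.log_mul hn0.ne' (by positivity)]
      exact Real.log_nonneg hge
    have hlog := log_tail_bound hr hℓ rfl hβ hβ0 hlw hlq hone
    refine (mul_le_mul_of_nonneg_right hbi (by positivity)).trans ?_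
    rw [mul_assoc]
    refine mul_le_mul_of_nonneg_left ?_ hn0.le
    rw [← Real.log_le_log_iff (by positivity) (by positivity), Real.log_mul (by positivity)
      (by positivity), Real.log_mul hq0.ne' hw0.ne', Real.log_mul (by positivity) (by positivity),
      Real.log_pow, Real.log_pow, Real.log_div hp0.ne' (by norm_num), hcast,
      Real.log_mul (by positivity) (by positivity), Real.log_mul (by positivity) (by positivity),
      Real.log_rpow (by positivity), Real.log_rpow (by norm_num),
      Real.log_mul (by norm_num) hn0.ne']
    rw [← T_mul_log] at hlog
    linarith
  refine (Finset.sum_le_card_nsmul _ _ _ hterm).trans_eq ?_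
  rw [Nat.card_Icc, Nat.add_sub_cancel, nsmul_eq_mul, Real.mul_rpow (by norm_num) hn0.le,
    Real.rpow_add hn0, Real.rpow_two]
  ring

end QuantumErrorDetection

end

theorem theorem1 (R p : ℝ) (hR0 : 0 ≤ R) (hR1 : R ≤ 1) (hp0 : 0 < p) (hp1 : p ≤ 1) :
    (R ≤ 2 * (1 - QuantumErrorDetection.H 4 p) - 1 →
      ((QuantumErrorDetection.T 4 (QuantumErrorDetection.Hinv 4 ((1 - R) / 2)) p : ℝ) : EReal)
        ≤ QuantumErrorDetection.lowerExponent R p) ∧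
    (2 * (1 - QuantumErrorDetection.H 4 p) - 1 ≤ R →
      (((1 - R) / 2 : ℝ) : EReal) ≤ QuantumErrorDetection.lowerExponent R p) := by
  refine ⟨fun hR => ?_, fun _ =>
    QuantumErrorDetection.half_one_sub_le_lowerExponent hR0 hR1 hp0.le hp1⟩
  obtain ⟨hδ, hH⟩ := QuantumErrorDetection.Hinv_spec (y := (1 - R) / 2) (by linarith) (by linarith)
  set δ := QuantumErrorDetection.Hinv 4 ((1 - R) / 2)
  have hp34 : p ≤ 3 / 4 := QuantumErrorDetection.le_three_quarters_of_H_le hp1 (by linarith)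
  have hpδ : p ≤ δ := by
    refine (QuantumErrorDetection.H_strictMonoOn.le_iff_le ⟨hp0.le, hp34⟩ hδ).mp ?_
    linarith
  -- Equality would force `(1 - R) / 2 = 1`, that is `R = -1`.
  have hδ34 : δ < 3 / 4 := by
    refine hδ.2.lt_of_ne fun h => ?_
    rw [h, QuantumErrorDetection.H_three_quarters] at hH
    linarith
  exact QuantumErrorDetection.T_le_lowerExponent hR0 hR1 hp0 hpδ hδ34 hH
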